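/- For a real number $\xi$ let $\|\xi\|$ denote the distance from $\xi$ to the nearest integer. Let $f\in\mathbb{R}[x]$ be a real polynomial of degree $d\ge 1$. Then the set $$\Big\{\alpha\in\mathbb{R}:\ \liminf_{n\to\infty}\, n\log n\,\|\alpha f(n)\|>0\Big\}$$ (where $n$ runs through the natural numbers and the lower limit is allowed to be $+\infty$) has Hausdorff dimension strictly greater than $\frac{d}{d+1}$; in particular it is nonempty. Moreover, W. Schmidt's question whether $\liminf_{n\to\infty} n\log n\,\|\alpha n^2\|=0$ holds for every real $\alpha$ has a negative answer: there is a real $\alpha$ for which this lower limit is not $0$. -/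

import Mathlib

open Filter Polynomial
open scoped ENNReal

/-- The distance `‖ξ‖` from a real number `ξ` to the nearest integer. -/
noncomputable def distNearestInt (ξ : ℝ) : ℝ := |ξ - (round ξ : ℝ)|

/-- `liminf_{n → ∞} n log n ‖α t_n‖` along the natural numbers. It is taken in the extended
reals because it can be `+∞`. -/
noncomputable def liminfNLogN (t : ℕ → ℝ) (α : ℝ) : EReal :=
  liminf (fun n : ℕ => (((n : ℝ) * Real.log n * distNearestInt (α * t n) : ℝ) : EReal)) atTop

/-- The set of all real `α` with `liminf_{n → ∞} n log n ‖α f(n)‖ > 0`. -/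
def positiveLiminfSet (f : ℝ[X]) : Set ℝ :=
  {α : ℝ | 0 < liminfNLogN (fun n : ℕ => f.eval (n : ℝ)) α}

/-! The dimension is shown to be at least every `s < 1`; only `|f n| ≍ n ^ d` matters. Put `N i = N₀
^ 4 ^ i` and build a Cantor set from intervals of length `ℓ i ≍ (N i) ^ (-d)`, excluding the `δ
j`-neighbourhoods with `δ j ≍ 1 / (j log j)` one block `N i < j ≤ N (i + 1)` at a time. Over such a
block the sum of `δ j` is bounded by a small constant, because `log N (i + 1) = 4 log N i`.

A block is handled with a delay. At level `i` the conditions already oscillate, so the doubled bad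
set has relative measure at most `1/16`; by Markov it stays below `1/4` in most intervals of level
`i + 1`. At level `i + 2` intervals are so short that one touching the bad set lies in the doubled
one, so few are lost. Each step thus keeps half of the children (`exists_half_children_avoiding`).

The total loss `2 ^ i` is negligible against `ℓ i`, which decays doubly exponentially, so no
dimension is lost (`le_dimH_of_half_children`, `two_pow_mul_rpow_le`). -/

/-! ### Dimension of Cantor-type sets -/

/-- The inverse of `x` is `s`-Hölder and maps onto an interval of dimension 1; such a map multiplies
dimension by at most `1 / s`. -/
theorem dimH_image_ge_of_rpow_bound {x : ℝ → ℝ} {C s : ℝ} (hs0 : 0 < s)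
    (h : ∀ y ∈ Set.Ico (0 : ℝ) 1, ∀ y' ∈ Set.Ico (0 : ℝ) 1, y < y' →
      y' - y ≤ C * |x y' - x y| ^ s) :
    ENNReal.ofReal s ≤ dimH (x '' Set.Ico (0 : ℝ) 1) := by
  have hC : ∀ y ∈ Set.Ico (0 : ℝ) 1, ∀ y' ∈ Set.Ico (0 : ℝ) 1,
      |y - y'| ≤ C.toNNReal * |x y - x y'| ^ s := by
    intro y hy y' hy'
    have hle : C ≤ (C.toNNReal : ℝ) := Real.le_coe_toNNReal C
    have key : ∀ a : ℝ, 0 ≤ a → C * a ≤ C.toNNReal * a := fun a ha =>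
      mul_le_mul_of_nonneg_right hle ha
    rcases lt_trichotomy y y' with hlt | heq | hlt
    · rw [abs_sub_comm, abs_of_pos (sub_pos.2 hlt), abs_sub_comm (x y)]
      exact (h y hy y' hy' hlt).trans (key _ (by positivity))
    · subst heq; simp; positivity
    · rw [abs_of_pos (sub_pos.2 hlt)]
      exact (h y' hy' y hy hlt).trans (key _ (by positivity))
  set I : Set ℝ := Set.Ico (0 : ℝ) 1
  have hinj : Set.InjOn x I := by
    intro y hy y' hy' hxy
    have := hC y hy y' hy'
    rw [hxy, sub_self, abs_zero, Real.zero_rpow hs0.ne', mul_zero] at this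
    exact sub_eq_zero.1 (abs_nonpos_iff.1 this)
  set g := Function.invFunOn x I
  have hg : ∀ y ∈ I, g (x y) = y := fun y hy => hinj.leftInvOn_invFunOn hy
  have hhold : HolderOnWith C.toNNReal s.toNNReal g (x '' I) := by
    rintro _ ⟨y, hy, rfl⟩ _ ⟨y', hy', rfl⟩
    rw [hg y hy, hg y' hy', edist_dist, edist_dist, Real.dist_eq, Real.dist_eq,
      Real.coe_toNNReal _ hs0.le, ENNReal.ofReal_rpow_of_nonneg (abs_nonneg _) hs0.le]
    refine (ENNReal.ofReal_le_ofReal (hC y hy y' hy')).trans ?_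
    rw [ENNReal.ofReal_mul (by positivity), ENNReal.ofReal_coe_nnreal]
  have himg : g '' (x '' I) = I := by
    ext z; constructor
    · rintro ⟨_, ⟨y, hy, rfl⟩, rfl⟩; rwa [hg y hy]
    · intro hz; exact ⟨x z, ⟨z, hz, rfl⟩, hg z hz⟩
  have hdim := hhold.dimH_image_le (by simpa using hs0)
  have hI : dimH I = 1 := by
    have := Real.dimH_of_nonempty_interior (E := ℝ) (s := I) (by simp [I])
    simpa using this
  rw [himg, hI, ENNReal.le_div_iff_mul_le (by left; simpa using hs0) (by left; simp), one_mul] at hdim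
  exact hdim

/-- Use the first scale with `ℓ i ≤ r`: the previous one exceeds `r`, which turns `hC` into a bound
on `2 ^ i * r ^ (1 - s)`. -/
theorem le_rpow_of_dyadic_scale_bounds {ℓ : ℕ → ℝ} {s C : ℝ} (hs0 : 0 < s) (hs1 : s < 1)
    (hpos : ∀ i, 0 < ℓ i) (hlim : Tendsto ℓ atTop (nhds 0)) (hC : ∀ i, 2 ^ i * ℓ i ^ (1 - s) ≤ C)
    {r t : ℝ} (ht : 0 < t) (ht1 : t ≤ 1)
    (h : ∀ i, t ≤ 2 ^ i / ℓ 0 * (r + 2 * ℓ i)) :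
    t ≤ (6 * C / ℓ 0 + (1 / ℓ 0) ^ s) * |r| ^ s := by
  have h0 := hpos 0
  have hC0 : 0 < C := lt_of_lt_of_le (by have := hpos 0; positivity) (hC 0)
  have hr : 0 < r := by
    by_contra hr
    push Not at hr
    have hb : ∀ i, t ≤ 2 * C / ℓ 0 * ℓ i ^ s := by
      intro i
      have hi := hpos i
      have e : ℓ i = ℓ i ^ (1 - s) * ℓ i ^ s := by
        rw [← Real.rpow_add hi]; simp
      calc t ≤ 2 ^ i / ℓ 0 * (r + 2 * ℓ i) := h i
        _ ≤ 2 ^ i / ℓ 0 * (2 * ℓ i) := by gcongr; linarith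
        _ = 2 / ℓ 0 * (2 ^ i * ℓ i ^ (1 - s)) * ℓ i ^ s := by nth_rewrite 1 [e]; ring
        _ ≤ 2 / ℓ 0 * C * ℓ i ^ s := by gcongr; exact hC i
        _ = _ := by ring
    have hl : Tendsto (fun i => 2 * C / ℓ 0 * ℓ i ^ s) atTop (nhds 0) := by
      have := (hlim.rpow_const (p := s) (Or.inr hs0.le)).const_mul (2 * C / ℓ 0)
      simpa [Real.zero_rpow hs0.ne'] using this
    exact absurd (ge_of_tendsto' hl hb) (not_le.2 ht)
  rw [abs_of_pos hr, add_mul]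
  by_cases hrl : ℓ 0 ≤ r
  · have h1 : 1 ≤ (1 / ℓ 0) ^ s * r ^ s := by
      rw [← Real.mul_rpow (by positivity) hr.le]
      apply Real.one_le_rpow _ hs0.le
      rw [one_div, inv_mul_eq_div, le_div_iff₀ h0]; linarith
    have : 0 ≤ 6 * C / ℓ 0 * r ^ s := by positivity
    linarith
  · have hex : ∃ i, ℓ i ≤ r := (hlim.eventually (gt_mem_nhds hr)).exists.imp fun _ h => h.le
    classical
    obtain ⟨i, hi⟩ : ∃ i, Nat.find hex = i + 1 := Nat.exists_eq_succ_of_ne_zero (by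
      intro h0; exact hrl (h0 ▸ Nat.find_spec hex))
    have h1 : ℓ (i + 1) ≤ r := hi ▸ Nat.find_spec hex
    have h2 : r < ℓ i := not_le.1 (Nat.find_min hex (by omega))
    have e : r = r ^ (1 - s) * r ^ s := by
      rw [← Real.rpow_add hr]; simp
    have hC' : 2 ^ i * r ^ (1 - s) ≤ C := by
      refine le_trans ?_ (hC i)
      gcongr
    have : t ≤ 6 * C / ℓ 0 * r ^ s := by
      calc t ≤ 2 ^ (i + 1) / ℓ 0 * (r + 2 * ℓ (i + 1)) := h (i + 1)
        _ ≤ 2 ^ (i + 1) / ℓ 0 * (3 * r) := by gcongr; linarith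
        _ = 6 / ℓ 0 * (2 ^ i * r ^ (1 - s)) * r ^ s := by nth_rewrite 1 [e]; ring
        _ ≤ 6 / ℓ 0 * C * r ^ s := by gcongr
        _ = _ := by ring
    have h3 : 0 ≤ (1 / ℓ 0) ^ s * r ^ s := by positivity
    linarith

/-- A Cantor-type set in which every chosen interval of level `i`, of length `ℓ i`, is cut into
`2 * K i` equal parts, of which at least half are chosen, has dimension at least `s` as soon as
`2 ^ i * ℓ i ^ (1 - s)` is bounded. -/
theorem le_dimH_of_half_children {ℓ : ℕ → ℝ} {K : ℕ → ℕ} {G : ℕ → ℝ → Prop} {u₀ s C : ℝ}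
    (hs0 : 0 < s) (hs1 : s < 1) (hpos : ∀ i, 0 < ℓ i) (hK : ∀ i, 0 < K i)
    (hℓ : ∀ i, ℓ i = 2 * K i * ℓ (i + 1)) (hC : ∀ i, 2 ^ i * ℓ i ^ (1 - s) ≤ C)
    (hG : G 0 u₀)
    (hstep : ∀ i u, G i u → ∃ T ⊆ Finset.range (2 * K i), K i ≤ T.card ∧
      ∀ q ∈ T, G (i + 1) (u + q * ℓ (i + 1))) :
    ENNReal.ofReal s ≤
      dimH {x : ℝ | ∀ i, ∃ u, G i u ∧ x ∈ Set.Icc u (u + ℓ i)} := by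
  have hstep' : ∀ i u, ∃ e : ℕ → ℕ, G i u → (∀ q q', q < q' → q' < K i → e q < e q') ∧
      ∀ q < K i, e q < 2 * K i ∧ G (i + 1) (u + e q * ℓ (i + 1)) := by
    intro i u
    by_cases hu : G i u
    · obtain ⟨T, hT, hc, hTG⟩ := hstep i u hu
      refine ⟨fun q => if h : q < K i then T.orderEmbOfCardLe hc ⟨q, h⟩ else 0, fun _ => ⟨?_, ?_⟩⟩
      · intro q q' hq hq'
        simp only [hq', hq.trans hq', dif_pos]
        exact (T.orderEmbOfCardLe hc).strictMono hq
      · intro q hq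
        simp only [hq, dif_pos]
        have hm := T.orderEmbOfCardLe_mem hc ⟨q, hq⟩
        exact ⟨Finset.mem_range.1 (hT hm), hTG _ hm⟩
    · exact ⟨fun _ => 0, fun h => absurd h hu⟩
  choose e he using hstep'
  -- Left endpoints in mixed radix: interval `q` is child number `q % K i` of interval `q / K i`, so
  -- the order of indices is the order on the line.
  let L : ℕ → ℕ → ℝ := fun i => Nat.rec (fun _ => u₀)
    (fun i Li q => Li (q / K i) + e i (Li (q / K i)) (q % K i) * ℓ (i + 1)) i
  have hL : ∀ i q, L (i + 1) q = L i (q / K i) + e i (L i (q / K i)) (q % K i) * ℓ (i + 1) :=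
    fun i q => rfl
  let P : ℕ → ℕ := fun i => ∏ j ∈ Finset.range i, K j
  have hP : ∀ i, P (i + 1) = P i * K i := fun i => Finset.prod_range_succ _ _
  have hdiv : ∀ i q, q < P (i + 1) → q / K i < P i := fun i q hq => by
    rw [Nat.div_lt_iff_lt_mul (hK i), ← hP]; exact hq
  have hLG : ∀ i q, q < P i → G i (L i q) := by
    intro i
    induction i with
    | zero => intro q _; exact hG
    | succ i ih =>
      intro q hq
      rw [hL]
      exact ((he i _ (ih _ (hdiv i q hq))).2 _ (Nat.mod_lt _ (hK i))).2
  have hsub : ∀ i q, q < P (i + 1) → L i (q / K i) ≤ L (i + 1) q ∧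
      L (i + 1) q + ℓ (i + 1) ≤ L i (q / K i) + ℓ i := by
    intro i q hq
    rw [hL, hℓ i]
    have h1 := ((he i _ (hLG i _ (hdiv i q hq))).2 _ (Nat.mod_lt q (hK i))).1
    have h2 : (e i (L i (q / K i)) (q % K i) : ℝ) + 1 ≤ 2 * K i := by exact_mod_cast h1
    have h3 := mul_le_mul_of_nonneg_right h2 (hpos (i + 1)).le
    have h4 : 0 ≤ (e i (L i (q / K i)) (q % K i) : ℝ) * ℓ (i + 1) :=
      mul_nonneg (Nat.cast_nonneg _) (hpos _).le
    constructor <;> linarith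
  have hgap : ∀ i q q', q < q' → q' < P i → L i q + ℓ i ≤ L i q' := by
    intro i
    induction i with
    | zero => intro q q' h h'; simp [P] at h'; omega
    | succ i ih =>
      intro q q' h h'
      rcases (Nat.div_le_div_right (c := K i) h.le).lt_or_eq with hlt | heq
      · have h1 := ih _ _ hlt (hdiv i q' h')
        have h2 := (hsub i q (h.trans h')).2
        have h3 := (hsub i q' h').1
        linarith
      · have hmod : q % K i < q' % K i := by
          have a1 := Nat.div_add_mod q (K i)
          have a2 := Nat.div_add_mod q' (K i)
          rw [heq] at a1; omega
        rw [hL, hL, heq]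
        have h1 := (he i _ (hLG i _ (hdiv i q' h'))).1 _ _ hmod (Nat.mod_lt _ (hK i))
        have h2 : (e i (L i (q' / K i)) (q % K i) : ℝ) + 1 ≤ e i (L i (q' / K i)) (q' % K i) := by
          exact_mod_cast h1
        have h3 := mul_le_mul_of_nonneg_right h2 (hpos (i + 1)).le
        linarith
  have hgaps : ∀ i q n, q + n < P i → L i q + n * ℓ i ≤ L i (q + n) := by
    intro i q n
    induction n with
    | zero => intro _; simp
    | succ n ih =>
      intro h
      have h1 := ih (by omega)
      have h2 := hgap i (q + n) (q + (n + 1)) (by omega) h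
      push_cast
      linarith
  have hPℓ : ∀ i, (P i : ℝ) * ℓ i = ℓ 0 / 2 ^ i := by
    intro i
    induction i with
    | zero => simp [P]
    | succ i ih =>
      rw [hP, pow_succ, ← div_div, ← ih, hℓ i]; push_cast; ring
  have hhalf : ∀ i, ℓ i ≤ ℓ 0 * (1 / 2) ^ i := by
    intro i
    induction i with
    | zero => simp
    | succ i ih =>
      have h1 : (1 : ℝ) ≤ K i := by exact_mod_cast hK i
      have h2 := mul_le_mul_of_nonneg_right h1 (hpos (i + 1)).le
      rw [pow_succ]
      have := hℓ i
      nlinarith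
  have hlim : Tendsto ℓ atTop (nhds 0) := by
    refine squeeze_zero (fun i => (hpos i).le) hhalf ?_
    simpa using (tendsto_pow_atTop_nhds_zero_of_lt_one (r := (1 / 2 : ℝ))
      (by norm_num) (by norm_num)).const_mul (ℓ 0)
  let p : ℕ → ℝ → ℕ := fun i y => ⌊y * P i⌋₊
  have hPpos : ∀ i, 0 < P i := fun i => Finset.prod_pos fun j _ => hK j
  have hp : ∀ i, ∀ y ∈ Set.Ico (0 : ℝ) 1, p i y < P i := by
    intro i y hy
    have : (0 : ℝ) < P i := by exact_mod_cast hPpos i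
    exact (Nat.floor_lt (mul_nonneg hy.1 this.le)).2 (by nlinarith [hy.2])
  have hpdiv : ∀ i y, p (i + 1) y / K i = p i y := by
    intro i y
    have hk : (K i : ℝ) ≠ 0 := by exact_mod_cast (hK i).ne'
    simp only [p]
    rw [← Nat.floor_div_natCast, hP]
    congr 1
    push_cast
    field_simp
  have hnest : ∀ y ∈ Set.Ico (0 : ℝ) 1, ∃ x, ∀ i, x ∈ Set.Icc (L i (p i y)) (L i (p i y) + ℓ i) := by
    intro y hy
    have hs : ∀ i, L i (p i y) ≤ L (i + 1) (p (i + 1) y) ∧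
        L (i + 1) (p (i + 1) y) + ℓ (i + 1) ≤ L i (p i y) + ℓ i := fun i => by
      simpa only [hpdiv] using hsub i _ (hp (i + 1) y hy)
    have hmono : Monotone fun i => L i (p i y) := monotone_nat_of_le_succ fun i => (hs i).1
    have hanti : Antitone fun i => L i (p i y) + ℓ i := antitone_nat_of_succ_le fun i => (hs i).2
    have hle : ∀ i j, L i (p i y) ≤ L j (p j y) + ℓ j := fun i j =>
      (hmono (le_max_left i j)).trans
        ((le_add_of_nonneg_right (hpos _).le).trans (hanti (le_max_right i j)))
    refine ⟨⨆ i, L i (p i y), fun i => ⟨le_ciSup (f := fun i => L i (p i y)) ⟨L 0 (p 0 y) + ℓ 0, ?_⟩ i, ciSup_le fun j => hle j i⟩⟩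
    rintro _ ⟨j, rfl⟩
    exact hle j 0
  choose! x hx using hnest
  refine (dimH_image_ge_of_rpow_bound (x := x) (C := 6 * C / ℓ 0 + (1 / ℓ 0) ^ s) hs0 ?_).trans
    (dimH_mono ?_)
  · intro y hy y' hy' hlt
    refine le_rpow_of_dyadic_scale_bounds hs0 hs1 hpos hlim hC (sub_pos.2 hlt)
      (by linarith [hy.1, hy'.2]) fun i => ?_
    have h1 := (hx y hy i).2
    have h2 := (hx y' hy' i).1
    have hPi : (0 : ℝ) < P i := by exact_mod_cast hPpos i
    have hle : p i y ≤ p i y' := Nat.floor_le_floor (by gcongr)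
    obtain ⟨n, hn⟩ := Nat.exists_eq_add_of_le hle
    have h3 := hgaps i (p i y) n (hn ▸ hp i y' hy')
    rw [← hn] at h3
    have h4 : (p i y : ℝ) ≤ y * P i := Nat.floor_le (mul_nonneg hy.1 hPi.le)
    have h5 : y' * P i < p i y' + 1 := Nat.lt_floor_add_one _
    have h6 : (p i y' : ℝ) = p i y + n := by exact_mod_cast hn
    have h7 : (y' - y) * P i - 1 ≤ n := by linarith
    have h8 := mul_le_mul_of_nonneg_right h7 (hpos i).le
    -- One `ℓ i` is lost to the floors, the other to the position of `x y` inside its interval.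
    have h9 : (y' - y) * (ℓ 0 / 2 ^ i) ≤ x y' - x y + 2 * ℓ i := by
      rw [← hPℓ i]; linarith
    have h0 := hpos 0
    calc y' - y = 2 ^ i / ℓ 0 * ((y' - y) * (ℓ 0 / 2 ^ i)) := by field_simp
      _ ≤ _ := by gcongr
  · rintro _ ⟨y, hy, rfl⟩ i
    exact ⟨_, hLG i _ (hp i y hy), hx y hy i⟩

/-! ### Measure of the near-integer sets -/

/-- The set of `x` for which `x * t` is at distance less than `η` from an integer. -/
def nearIntSet (t η : ℝ) : Set ℝ := {x | ∃ k : ℤ, |x * t - k| < η}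

open MeasureTheory

theorem nearIntSet_neg (t η : ℝ) : nearIntSet (-t) η = nearIntSet t η := by
  ext x
  constructor <;> rintro ⟨k, hk⟩ <;> refine ⟨-k, ?_⟩ <;> rw [← abs_neg] <;>
    convert hk using 2 <;> push_cast <;> ring

theorem volume_Ico_inter_nearIntSet_le_of_pos {t η u ℓ : ℝ} (hη : 0 < η) (hη' : η ≤ 1 / 2)
    (ht : 0 < t) (htℓ : 1 ≤ t * ℓ) :
    volume (Set.Ico u (u + ℓ) ∩ nearIntSet t η) ≤ ENNReal.ofReal (6 * η * ℓ) := by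
  have hsub : Set.Ico u (u + ℓ) ∩ nearIntSet t η ⊆
      ⋃ k ∈ Finset.Icc ⌈u * t - η⌉ ⌊(u + ℓ) * t + η⌋, Set.Ioo ((k - η) / t) ((k + η) / t) := by
    rintro x ⟨⟨hx1, hx2⟩, k, hk⟩
    rw [abs_lt] at hk
    simp only [Set.mem_iUnion, Finset.mem_Icc, Set.mem_Ioo, div_lt_iff₀ ht, lt_div_iff₀ ht,
      Int.ceil_le, Int.le_floor]
    have h1 := mul_le_mul_of_nonneg_right hx1 ht.le
    have h2 := mul_lt_mul_of_pos_right hx2 ht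
    exact ⟨k, ⟨by linarith, by linarith⟩, by linarith, by linarith⟩
  refine (measure_mono hsub).trans ((measure_biUnion_finset_le _ _).trans ?_)
  have hlen : ∀ k : ℤ, ((k + η) / t - (k - η) / t) = 2 * η / t := fun k => by ring
  simp only [Real.volume_Ioo, hlen, Finset.sum_const, Int.card_Icc, nsmul_eq_mul]
  rw [← ENNReal.ofReal_natCast, ← ENNReal.ofReal_mul (Nat.cast_nonneg _)]
  apply ENNReal.ofReal_le_ofReal
  -- At most `t * ℓ + 2 * η + 1` integers occur, and both `2 * η` and `1` are at most `t * ℓ`.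
  have hcard : ((⌊(u + ℓ) * t + η⌋ + 1 - ⌈u * t - η⌉).toNat : ℝ) ≤ 3 * (t * ℓ) := by
    rw [← Int.cast_natCast, Int.toNat_eq_max, Int.cast_max]
    push_cast
    apply max_le _ (by linarith)
    have h1 := Int.floor_le ((u + ℓ) * t + η)
    have h2 := Int.le_ceil (u * t - η)
    linarith
  calc _ ≤ 3 * (t * ℓ) * (2 * η / t) := by gcongr
    _ = _ := by field_simp; ring

theorem volume_Ico_inter_nearIntSet_le {t η u ℓ : ℝ} (hη : 0 < η) (hη' : η ≤ 1 / 2)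
    (htℓ : 1 ≤ |t| * ℓ) :
    volume (Set.Ico u (u + ℓ) ∩ nearIntSet t η) ≤ ENNReal.ofReal (6 * η * ℓ) := by
  have ht : t ≠ 0 := by rintro rfl; norm_num at htℓ
  have habs : nearIntSet |t| η = nearIntSet t η := by
    rcases abs_choice t with h | h <;> rw [h]
    exact nearIntSet_neg t η
  rw [← habs]
  exact volume_Ico_inter_nearIntSet_le_of_pos hη hη' (abs_pos.2 ht) htℓ

theorem Icc_subset_nearIntSet_two_mul {t η u ℓ x : ℝ} (htℓ : |t| * ℓ ≤ η)
    (hx : x ∈ Set.Icc u (u + ℓ)) (hxt : x ∈ nearIntSet t η) :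
    Set.Icc u (u + ℓ) ⊆ nearIntSet t (2 * η) := by
  intro y hy
  obtain ⟨k, hk⟩ := hxt
  refine ⟨k, ?_⟩
  have h1 : |y - x| ≤ ℓ := by
    rw [abs_le]; constructor <;> linarith [hx.1, hx.2, hy.1, hy.2]
  calc |y * t - k| = |(y - x) * t + (x * t - k)| := by ring_nf
    _ ≤ |y - x| * |t| + |x * t - k| := by rw [← abs_mul]; exact abs_add_le _ _
    _ < ℓ * |t| + η := add_lt_add_of_le_of_lt (by gcongr) hk
    _ ≤ 2 * η := by linarith

/-! ### Choosing half of the children -/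

theorem sum_volume_Ico_inter_le (V : Set ℝ) (u : ℝ) {ℓ : ℝ} (hℓ : 0 < ℓ) (M : ℕ) :
    ∑ q ∈ Finset.range M, volume (Set.Ico (u + q * ℓ) (u + q * ℓ + ℓ) ∩ V) ≤
      volume (Set.Ico u (u + M * ℓ) ∩ V) := by
  induction M with
  | zero => simp
  | succ M ih =>
    rw [Finset.sum_range_succ]
    have hM : 0 ≤ (M : ℝ) * ℓ := by positivity
    have hsplit : Set.Ico u (u + (M + 1 : ℕ) * ℓ) =
        Set.Ico u (u + M * ℓ) ∪ Set.Ico (u + M * ℓ) (u + M * ℓ + ℓ) := by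
      rw [Set.Ico_union_Ico_eq_Ico (by linarith) (by linarith)]
      congr 1; push_cast; ring
    rw [← measure_inter_add_sdiff (Set.Ico u (u + (M + 1 : ℕ) * ℓ) ∩ V)
      (measurableSet_Ico (a := u) (b := u + M * ℓ))]
    refine add_le_add (ih.trans (measure_mono ?_)) (measure_mono ?_)
    · rintro x ⟨hx, hV⟩
      exact ⟨⟨hsplit ▸ Or.inl hx, hV⟩, hx⟩
    · rintro x ⟨hx, hV⟩
      exact ⟨⟨hsplit ▸ Or.inr hx, hV⟩, fun h => absurd h.2 (not_lt.2 hx.1)⟩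

/-- The Markov inequality for the parts of an interval cut into `M` equal parts. -/
theorem card_mul_le_of_volume_Ico_inter_le {V : Set ℝ} {u ℓ a b : ℝ} (hℓ : 0 < ℓ) (ha : 0 ≤ a)
    {M : ℕ} {T : Finset ℕ} (hT : T ⊆ Finset.range M)
    (hV : volume (Set.Ico u (u + M * ℓ) ∩ V) ≤ ENNReal.ofReal (a * (M * ℓ)))
    (hq : ∀ q ∈ T, ENNReal.ofReal (b * ℓ) ≤
      volume (Set.Ico (u + q * ℓ) (u + q * ℓ + ℓ) ∩ V)) :
    T.card * b ≤ a * M := by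
  have h1 : ENNReal.ofReal (T.card * (b * ℓ)) ≤ ENNReal.ofReal (a * (M * ℓ)) := by
    calc ENNReal.ofReal (T.card * (b * ℓ)) = ∑ q ∈ T, ENNReal.ofReal (b * ℓ) := by
          rw [Finset.sum_const, nsmul_eq_mul, ENNReal.ofReal_mul (Nat.cast_nonneg _),
            ENNReal.ofReal_natCast]
      _ ≤ ∑ q ∈ T, volume (Set.Ico (u + q * ℓ) (u + q * ℓ + ℓ) ∩ V) := Finset.sum_le_sum hq
      _ ≤ ∑ q ∈ Finset.range M, volume (Set.Ico (u + q * ℓ) (u + q * ℓ + ℓ) ∩ V) :=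
          Finset.sum_le_sum_of_subset hT
      _ ≤ _ := (sum_volume_Ico_inter_le V u hℓ M).trans hV
  rw [ENNReal.ofReal_le_ofReal_iff (by positivity)] at h1
  have h2 : T.card * b * ℓ ≤ a * M * ℓ := by linarith
  exact le_of_mul_le_mul_right h2 hℓ

/-- Bound `1 / j` by `log j - log (j - 1)` and `log j` below by `log N`, then telescope. -/
theorem sum_Ioc_inv_mul_log_le {N : ℕ} (hN : 2 ≤ N) (m : ℕ) :
    ∑ j ∈ Finset.Ioc N (N ^ (m + 1)), 1 / ((j : ℝ) * Real.log j) ≤ m := by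
  have hlogN : 0 < Real.log N := Real.log_pos (by exact_mod_cast hN)
  have hstep : ∀ n, N ≤ n → ∑ j ∈ Finset.Ioc N n, 1 / ((j : ℝ) * Real.log j) ≤
      (Real.log n - Real.log N) / Real.log N := by
    intro n hn
    induction n, hn using Nat.le_induction with
    | base => simp
    | succ n hn ih =>
      rw [Finset.sum_Ioc_succ_top (by omega)]
      have hn0 : (0 : ℝ) < n := by exact_mod_cast (by omega : 0 < n)
      have h1 : 1 / ((n : ℝ) + 1) ≤ Real.log (n + 1) - Real.log n := by
        have := Real.one_sub_inv_le_log_of_pos (x := ((n : ℝ) + 1) / n) (by positivity)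
        rw [Real.log_div (by positivity) hn0.ne', inv_div] at this
        refine le_trans (le_of_eq ?_) this
        field_simp; ring
      have h2 : Real.log N ≤ Real.log ((n : ℝ) + 1) :=
        Real.log_le_log (by exact_mod_cast (by omega : 0 < N)) (by exact_mod_cast (by omega))
      have h3 : 1 / (((n : ℝ) + 1) * Real.log (n + 1)) ≤
          (Real.log (n + 1) - Real.log n) / Real.log N := by
        rw [← div_div]
        gcongr
        exact le_trans (by positivity) h1
      push_cast
      calc _ ≤ (Real.log n - Real.log N) / Real.log N +
          (Real.log (n + 1) - Real.log n) / Real.log N := add_le_add ih h3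
        _ = _ := by ring
  refine (hstep _ (Nat.le_self_pow (by omega) N)).trans (le_of_eq ?_)
  push_cast
  rw [Real.log_pow]
  push_cast
  field_simp
  ring

/-- Markov discards at most a quarter of the parts for each of `V` and `V'`. -/
theorem exists_half_of_volume_Ico_inter_le {V V' : Set ℝ} {u ℓ : ℝ} {M K : ℕ} (hM : M = 2 * K)
    (hℓ : 0 < ℓ)
    (hV : volume (Set.Ico u (u + M * ℓ) ∩ V) ≤ ENNReal.ofReal (1 / 4 * (M * ℓ)))
    (hV' : volume (Set.Ico u (u + M * ℓ) ∩ V') ≤ ENNReal.ofReal (1 / 16 * (M * ℓ))) :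
    ∃ T ⊆ Finset.range M, K ≤ T.card ∧ ∀ q ∈ T,
      volume (Set.Ico (u + q * ℓ) (u + q * ℓ + ℓ) ∩ V) < ENNReal.ofReal (1 * ℓ) ∧
      volume (Set.Ico (u + q * ℓ) (u + q * ℓ + ℓ) ∩ V') < ENNReal.ofReal (1 / 4 * ℓ) := by
  classical
  obtain ⟨T₁, hT₁⟩ : ∃ T : Finset ℕ, T = (Finset.range M).filter fun q : ℕ =>
    ENNReal.ofReal (1 * ℓ) ≤ volume (Set.Ico (u + q * ℓ) (u + q * ℓ + ℓ) ∩ V) := ⟨_, rfl⟩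
  obtain ⟨T₂, hT₂⟩ : ∃ T : Finset ℕ, T = (Finset.range M).filter fun q : ℕ =>
    ENNReal.ofReal (1 / 4 * ℓ) ≤ volume (Set.Ico (u + q * ℓ) (u + q * ℓ + ℓ) ∩ V') := ⟨_, rfl⟩
  have h1 : (T₁.card : ℝ) * 1 ≤ 1 / 4 * M :=
    card_mul_le_of_volume_Ico_inter_le hℓ (by norm_num) (hT₁ ▸ Finset.filter_subset _ _) hV
      fun q hq => by rw [hT₁] at hq; exact (Finset.mem_filter.1 hq).2
  have h2 : (T₂.card : ℝ) * (1 / 4) ≤ 1 / 16 * M :=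
    card_mul_le_of_volume_Ico_inter_le hℓ (by norm_num) (hT₂ ▸ Finset.filter_subset _ _) hV'
      fun q hq => by rw [hT₂] at hq; exact (Finset.mem_filter.1 hq).2
  refine ⟨Finset.range M \ (T₁ ∪ T₂), Finset.sdiff_subset, ?_, ?_⟩
  · have h3 : T₁.card + T₂.card ≤ K := by
      rw [hM] at h1 h2
      push_cast at h1 h2
      have : (T₁.card : ℝ) + T₂.card ≤ K := by linarith
      exact_mod_cast this
    have h4 := Finset.card_union_le T₁ T₂
    have h5 := Finset.le_card_sdiff (T₁ ∪ T₂) (Finset.range M)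
    rw [Finset.card_range] at h5
    omega
  · intro q hq
    rw [Finset.mem_sdiff, Finset.mem_union, not_or, hT₁, hT₂, Finset.mem_filter,
      Finset.mem_filter] at hq
    obtain ⟨hqR, hq1, hq2⟩ := hq
    exact ⟨not_le.1 fun h => hq1 ⟨hqR, h⟩, not_le.1 fun h => hq2 ⟨hqR, h⟩⟩

theorem exists_half_children_avoiding {t δ : ℕ → ℝ} {B B' : Finset ℕ} {u ℓ : ℝ} {M K : ℕ}
    (hM : M = 2 * K) (hℓ : 0 < ℓ) (hB : ∀ j ∈ B, |t j| * ℓ ≤ δ j)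
    (hV : volume (Set.Ico u (u + M * ℓ) ∩ ⋃ j ∈ B, nearIntSet (t j) (2 * δ j)) ≤
      ENNReal.ofReal (1 / 4 * (M * ℓ)))
    (hV' : volume (Set.Ico u (u + M * ℓ) ∩ ⋃ j ∈ B', nearIntSet (t j) (2 * δ j)) ≤
      ENNReal.ofReal (1 / 16 * (M * ℓ))) :
    ∃ T ⊆ Finset.range M, K ≤ T.card ∧ ∀ q ∈ T,
      volume (Set.Ico (u + q * ℓ) (u + q * ℓ + ℓ) ∩ ⋃ j ∈ B', nearIntSet (t j) (2 * δ j)) ≤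
        ENNReal.ofReal (1 / 4 * ℓ) ∧
      ∀ x ∈ Set.Icc (u + q * ℓ) (u + q * ℓ + ℓ), ∀ j ∈ B, x ∉ nearIntSet (t j) (δ j) := by
  obtain ⟨T, hT, hK, h⟩ := exists_half_of_volume_Ico_inter_le hM hℓ hV hV'
  refine ⟨T, hT, hK, fun q hq => ⟨(h q hq).2.le, fun x hx j hj hxj => ?_⟩⟩
  -- A part touching the `δ j`-set would lie wholly in the doubled set, against the strict volume
  -- bound.
  have hsub := Icc_subset_nearIntSet_two_mul (hB j hj) hx hxj
  have hlt := (h q hq).1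
  rw [Set.inter_eq_left.2, Real.volume_Ico, add_sub_cancel_left, one_mul] at hlt
  · exact lt_irrefl _ hlt
  · exact (Set.Ico_subset_Icc_self.trans hsub).trans
      (Set.subset_biUnion_of_mem (u := fun j => nearIntSet (t j) (2 * δ j)) hj)

theorem volume_Ico_inter_biUnion_nearIntSet_le {t : ℕ → ℝ} {u ℓ : ℝ} {N : ℕ} (hN : 2 ≤ N)
    (hℓ : 0 < ℓ) (ht : ∀ j, N < j → 1 ≤ |t j| * ℓ) :
    volume (Set.Ico u (u + ℓ) ∩ ⋃ j ∈ Finset.Ioc N (N ^ 4),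
      nearIntSet (t j) (2 * (1 / 576 * (1 / (j * Real.log j))))) ≤
      ENNReal.ofReal (1 / 16 * ℓ) := by
  have hlog : ∀ j : ℕ, N < j → 1 ≤ (j : ℝ) * Real.log j := by
    intro j hj
    have hj3 : (3 : ℝ) ≤ j := by exact_mod_cast (by omega : 3 ≤ j)
    have h1 : 1 - (j : ℝ)⁻¹ ≤ Real.log j := Real.one_sub_inv_le_log_of_pos (by linarith)
    have h2 : (j : ℝ) * (j : ℝ)⁻¹ = 1 := mul_inv_cancel₀ (by linarith)
    nlinarith
  simp only [Set.inter_iUnion]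
  refine (measure_biUnion_finset_le _ _).trans ?_
  calc _ ≤ ∑ j ∈ Finset.Ioc N (N ^ 4),
        ENNReal.ofReal (6 * (2 * (1 / 576 * (1 / (j * Real.log j)))) * ℓ) := by
        refine Finset.sum_le_sum fun j hj => ?_
        have hj' := (Finset.mem_Ioc.1 hj).1
        have h1 := hlog j hj'
        have h2 : 1 / ((j : ℝ) * Real.log j) ≤ 1 := by
          rw [div_le_one (by linarith)]; exact h1
        exact volume_Ico_inter_nearIntSet_le (by positivity) (by linarith) (ht j hj')
    _ = ENNReal.ofReal (∑ j ∈ Finset.Ioc N (N ^ 4),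
        6 * (2 * (1 / 576 * (1 / (j * Real.log j)))) * ℓ) := by
        refine (ENNReal.ofReal_sum_of_nonneg fun j hj => ?_).symm
        have h1 := hlog j (Finset.mem_Ioc.1 hj).1
        positivity
    _ ≤ _ := by
        apply ENNReal.ofReal_le_ofReal
        -- This fixes the constant: `6 * 2 * 3 / 576 = 1 / 16`.
        have h := sum_Ioc_inv_mul_log_le hN 3
        push_cast at h
        have e : ∑ j ∈ Finset.Ioc N (N ^ 4), 6 * (2 * (1 / 576 * (1 / (j * Real.log j)))) * ℓ =
            1 / 48 * ℓ * ∑ j ∈ Finset.Ioc N (N ^ 4), 1 / ((j : ℝ) * Real.log j) := by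
          rw [Finset.mul_sum]
          exact Finset.sum_congr rfl fun j _ => by ring
        rw [e]
        nlinarith

/-! ### The construction for sequences of polynomial growth -/

theorem two_pow_mul_rpow_le {A ε : ℝ} (hA : 0 < A) (hε : 0 < ε) {d N₀ : ℕ} (hd : 1 ≤ d)
    (hN₀ : 2 ≤ N₀) (i : ℕ) :
    2 ^ i * (A / ((N₀ ^ 4 ^ i : ℕ) : ℝ) ^ d) ^ ε ≤ A ^ ε * (1 / (ε * Real.log 2)) := by
  have hlog : 0 < Real.log 2 := Real.log_pos (by norm_num)
  have hN : (2 : ℝ) ^ (4 ^ i) ≤ ((N₀ ^ 4 ^ i : ℕ) : ℝ) ^ d := by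
    have h1 : 2 ^ 4 ^ i ≤ (N₀ ^ 4 ^ i) ^ d :=
      (Nat.pow_le_pow_left hN₀ _).trans (Nat.le_self_pow (by omega) _)
    exact_mod_cast h1
  have h2 : ε * Real.log 2 * 2 ^ i ≤ (((N₀ ^ 4 ^ i : ℕ) : ℝ) ^ d) ^ ε := by
    calc ε * Real.log 2 * 2 ^ i ≤ ε * Real.log 2 * 4 ^ i := by gcongr; norm_num
      _ ≤ Real.exp (ε * Real.log 2 * 4 ^ i) := by
          linarith [Real.add_one_le_exp (ε * Real.log 2 * 4 ^ i)]
      _ = ((2 : ℝ) ^ (4 ^ i)) ^ ε := by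
          rw [← Real.rpow_natCast 2 (4 ^ i), ← Real.rpow_mul (by norm_num), Real.rpow_def_of_pos (by norm_num)]
          push_cast; ring_nf
      _ ≤ _ := by gcongr
  have hpos : 0 < ((N₀ ^ 4 ^ i : ℕ) : ℝ) ^ d := lt_of_lt_of_le (by positivity) hN
  rw [Real.div_rpow hA.le hpos.le, mul_div_left_comm]
  refine mul_le_mul_of_nonneg_left ?_ (by positivity)
  rw [div_le_div_iff₀ (by positivity) (by positivity)]
  linarith

theorem le_dimH_of_polynomial_growth {t : ℕ → ℝ} {A : ℝ} {d n₀ : ℕ} (hd : 1 ≤ d) (hA : 0 < A)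
    (hlow : ∀ n : ℕ, n₀ ≤ n → (n : ℝ) ^ d ≤ A * |t n|)
    (hup : ∀ n : ℕ, n₀ ≤ n → |t n| ≤ A * (n : ℝ) ^ d) {s : ℝ} (hs0 : 0 < s) (hs1 : s < 1) :
    ENNReal.ofReal s ≤ dimH {x : ℝ | ∃ n₁ : ℕ, ∀ n : ℕ, n₁ < n →
      x ∉ nearIntSet (t n) (1 / 576 * (1 / (n * Real.log n)))} := by
  obtain ⟨m, hm⟩ := exists_nat_ge (576 * A ^ 2)
  -- Even, so that `N i ^ (3 * d)` halves exactly; at least `n₀` for the growth bounds, and at least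
  -- `m` to absorb `576 * A ^ 2`.
  set N₀ : ℕ := 2 * (m + n₀ + 1) with hN₀
  have hN₀2 : 2 ≤ N₀ := by omega
  let N : ℕ → ℕ := fun i => N₀ ^ 4 ^ i
  have hNs : ∀ i, N (i + 1) = N i ^ 4 := fun i => by simp only [N]; rw [← pow_mul, pow_succ]
  have hN0 : ∀ i, N₀ ≤ N i := fun i => Nat.le_self_pow (by positivity) _
  have hNeven : ∀ i, 2 ∣ N i := fun i => dvd_pow (Dvd.intro _ rfl) (by positivity)
  let K : ℕ → ℕ := fun i => N i ^ (3 * d) / 2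
  have hK : ∀ i, 2 * K i = N i ^ (3 * d) := fun i =>
    Nat.mul_div_cancel' (dvd_pow (hNeven i) (by omega))
  let ℓ : ℕ → ℝ := fun i => A / (N i : ℝ) ^ d
  have hNpos : ∀ i, (0 : ℝ) < N i := fun i => by
    have := hN0 i
    exact_mod_cast (by omega : 0 < N i)
  have hℓpos : ∀ i, 0 < ℓ i := fun i => div_pos hA (pow_pos (hNpos i) _)
  have hℓ : ∀ i, ℓ i = (2 * K i : ℕ) * ℓ (i + 1) := by
    intro i
    have := hNpos i
    simp only [ℓ, hK, hNs]
    push_cast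
    field_simp
    ring
  -- The shift encodes the delay: `B (i + 1)` starts after `N i`, is sparse at level `i + 1`, and is
  -- avoided from level `i + 2`.
  let B : ℕ → Finset ℕ := fun i => Nat.rec ∅ (fun i _ => Finset.Ioc (N i) (N (i + 1))) i
  let δ : ℕ → ℝ := fun j => 1 / 576 * (1 / (j * Real.log j))
  have hBℓ : ∀ i, ∀ j ∈ B i, |t j| * ℓ (i + 1) ≤ δ j := by
    intro i j hj
    cases i with
    | zero => simp [B] at hj
    | succ i =>
      obtain ⟨hj1, hj2⟩ := Finset.mem_Ioc.1 (show j ∈ Finset.Ioc (N i) (N (i + 1)) from hj)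
      have hNi := hN0 i
      have hj3 : (2 : ℝ) ≤ j := by exact_mod_cast (by omega : 2 ≤ j)
      have hlogpos : 0 < Real.log j := Real.log_pos (by linarith)
      have hlog : Real.log j ≤ j := (Real.log_le_sub_one_of_pos (by linarith)).trans (by linarith)
      have hjN : (j : ℝ) ≤ N (i + 1) := by exact_mod_cast hj2
      have hAN : 576 * A ^ 2 ≤ N (i + 1) := hm.trans (by
        have := hN0 (i + 1)
        exact_mod_cast (by omega : m ≤ N (i + 1)))
      have hN1 : (1 : ℝ) ≤ N (i + 1) := by linarith
      have hNp := hNpos (i + 1)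
      have hkey : 576 * A ^ 2 * (j : ℝ) ^ d * (j * Real.log j) ≤ (N (i + 1) : ℝ) ^ (4 * d) := by
        calc _ ≤ (N (i + 1) : ℝ) * (N (i + 1) : ℝ) ^ d * (N (i + 1) * N (i + 1)) := by
              gcongr; exact hlog.trans hjN
          _ = (N (i + 1) : ℝ) ^ (d + 3) := by ring
          _ ≤ _ := pow_le_pow_right₀ hN1 (by omega)
      calc |t j| * ℓ (i + 1 + 1) ≤ A * (j : ℝ) ^ d * (A / (N (i + 1) : ℝ) ^ (4 * d)) := by
            simp only [ℓ]
            rw [hNs (i + 1), Nat.cast_pow, ← pow_mul]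
            gcongr
            exact hup j (by omega)
        _ ≤ δ j := by
            simp only [δ]
            rw [← mul_div_assoc, ← mul_div_assoc, div_le_div_iff₀ (by positivity) (by positivity)]
            linarith
  have hBt : ∀ i j, N i < j → 1 ≤ |t j| * ℓ i := by
    intro i j hj
    have hNi := hN0 i
    have h1 := hlow j (by omega)
    have h2 : (N i : ℝ) ^ d ≤ (j : ℝ) ^ d := by gcongr
    simp only [ℓ]
    rw [← mul_div_assoc, le_div_iff₀ (pow_pos (hNpos i) _)]
    linarith
  let G : ℕ → ℝ → Prop := fun i u =>
    volume (Set.Ico u (u + ℓ i) ∩ ⋃ j ∈ B i, nearIntSet (t j) (2 * δ j)) ≤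
      ENNReal.ofReal (1 / 4 * ℓ i) ∧
    ∀ k, i = k + 1 → ∀ x ∈ Set.Icc u (u + ℓ i), ∀ j ∈ B k, x ∉ nearIntSet (t j) (δ j)
  refine (le_dimH_of_half_children (ℓ := ℓ) (K := K) (G := G) (u₀ := 0)
    (C := A ^ (1 - s) * (1 / ((1 - s) * Real.log 2))) hs0 hs1 hℓpos ?_ ?_ ?_ ?_ ?_).trans
    (dimH_mono ?_)
  · intro i
    have h1 := hK i
    have h2 : 0 < N i ^ (3 * d) := pow_pos (by have := hN0 i; omega) _
    omega
  · intro i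
    exact_mod_cast hℓ i
  · exact fun i => two_pow_mul_rpow_le hA (by linarith) hd hN₀2 i
  · exact ⟨by simp [B], fun k hk => by omega⟩
  · rintro i u ⟨hu, -⟩
    have hV' := volume_Ico_inter_biUnion_nearIntSet_le (u := u) (hN₀2.trans (hN0 i)) (hℓpos i)
      (hBt i)
    rw [← hNs i] at hV'
    rw [hℓ i] at hu hV'
    obtain ⟨T, hT, hcard, hTq⟩ := exists_half_children_avoiding (B' := B (i + 1)) rfl (hℓpos (i + 1))
      (hBℓ i) hu hV'
    refine ⟨T, hT, hcard, fun q hq => ⟨(hTq q hq).1, fun k hk => ?_⟩⟩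
    obtain rfl : i = k := by omega
    exact (hTq q hq).2
  · intro x hx
    refine ⟨N 0, fun n hn => ?_⟩
    have hex : ∃ i, n ≤ N i := ⟨n, by
      calc n ≤ 2 ^ n := Nat.lt_two_pow_self.le
        _ ≤ N₀ ^ n := Nat.pow_le_pow_left hN₀2 _
        _ ≤ N n := Nat.pow_le_pow_right (by omega) (Nat.lt_pow_self (by norm_num)).le⟩
    obtain ⟨i, hi⟩ : ∃ i, Nat.find hex = i + 1 := Nat.exists_eq_succ_of_ne_zero (by
      intro h0
      have := Nat.find_spec hex
      rw [h0] at this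
      omega)
    have h1 : n ≤ N (i + 1) := hi ▸ Nat.find_spec hex
    have h2 : N i < n := not_le.1 (Nat.find_min hex (by omega))
    obtain ⟨u, hu, hxu⟩ := hx (i + 2)
    exact hu.2 (i + 1) rfl x hxu n (Finset.mem_Ioc.2 ⟨h2, h1⟩)

theorem mem_positiveLiminfSet_of_forall_notMem_nearIntSet {f : ℝ[X]} {x c : ℝ} (hc : 0 < c)
    {n₁ : ℕ} (h : ∀ n : ℕ, n₁ < n →
      x ∉ nearIntSet (f.eval (n : ℝ)) (c * (1 / (n * Real.log n)))) :
    x ∈ positiveLiminfSet f := by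
  have hev : ∀ᶠ n : ℕ in atTop, (c : EReal) ≤
      (((n : ℝ) * Real.log n * distNearestInt (x * f.eval (n : ℝ)) : ℝ) : EReal) := by
    filter_upwards [eventually_gt_atTop n₁, eventually_ge_atTop 2] with n hn hn2
    have hn' : (2 : ℝ) ≤ n := by exact_mod_cast hn2
    have hpos : 0 < (n : ℝ) * Real.log n := mul_pos (by linarith) (Real.log_pos (by linarith))
    have h1 : c * (1 / (n * Real.log n)) ≤ distNearestInt (x * f.eval (n : ℝ)) := by
      by_contra hlt
      exact h n hn ⟨_, not_le.1 hlt⟩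
    rw [EReal.coe_le_coe_iff]
    rw [mul_one_div, div_le_iff₀ hpos] at h1
    linarith
  exact lt_of_lt_of_le (EReal.coe_pos.2 hc) (le_liminf_of_le (by isBoundedDefault) hev)

theorem exists_polynomial_eval_bounds {f : ℝ[X]} (hf : f ≠ 0) :
    ∃ A : ℝ, 0 < A ∧ ∃ n₀ : ℕ, ∀ n : ℕ, n₀ ≤ n →
      (n : ℝ) ^ f.natDegree ≤ A * |f.eval (n : ℝ)| ∧
      |f.eval (n : ℝ)| ≤ A * (n : ℝ) ^ f.natDegree := by
  have hlead : f.leadingCoeff ≠ 0 := leadingCoeff_ne_zero.2 hf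
  have hθ : (fun x : ℝ => f.eval x) =Θ[atTop] fun x : ℝ => x ^ f.natDegree :=
    f.isEquivalent_atTop_lead.isTheta.trans ((Asymptotics.isTheta_const_mul_left hlead).2
      (Asymptotics.isTheta_refl _ _))
  obtain ⟨a, ha, h1⟩ := hθ.1.exists_pos
  obtain ⟨b, hb, h2⟩ := hθ.2.exists_pos
  have h := tendsto_natCast_atTop_atTop.eventually (h1.bound.and h2.bound)
  obtain ⟨n₀, hn₀⟩ := eventually_atTop.1 h
  refine ⟨a + b, by positivity, n₀, fun n hn => ?_⟩
  obtain ⟨h3, h4⟩ := hn₀ n hn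
  simp only [norm_pow, Real.norm_eq_abs, Nat.abs_cast] at h3 h4
  have h5 : 0 ≤ a * |f.eval (n : ℝ)| := by positivity
  have h6 : 0 ≤ b * (n : ℝ) ^ f.natDegree := by positivity
  constructor <;> linarith

theorem le_dimH_positiveLiminfSet {f : ℝ[X]} (hf : 1 ≤ f.natDegree) {s : ℝ} (hs0 : 0 < s)
    (hs1 : s < 1) : ENNReal.ofReal s ≤ dimH (positiveLiminfSet f) := by
  obtain ⟨A, hA, n₀, h⟩ := exists_polynomial_eval_bounds (f := f) (by rintro rfl; simp at hf)
  refine (le_dimH_of_polynomial_growth hf hA (fun n hn => (h n hn).1) (fun n hn => (h n hn).2)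
    hs0 hs1).trans (dimH_mono ?_)
  rintro x ⟨n₁, hx⟩
  exact mem_positiveLiminfSet_of_forall_notMem_nearIntSet (by norm_num) hx

theorem mainTheorem2 :
    (∀ (f : ℝ[X]) (d : ℕ), 1 ≤ d → f.natDegree = d →
      (d : ℝ≥0∞) / ((d : ℝ≥0∞) + 1) < dimH (positiveLiminfSet f) ∧
      (positiveLiminfSet f).Nonempty) ∧
    ¬ (∀ α : ℝ, liminfNLogN (fun n : ℕ => (n : ℝ) ^ 2) α = 0) := by
  have main : ∀ (f : ℝ[X]) (d : ℕ), 1 ≤ d → f.natDegree = d →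
      (d : ℝ≥0∞) / ((d : ℝ≥0∞) + 1) < dimH (positiveLiminfSet f) ∧
      (positiveLiminfSet f).Nonempty := by
    rintro f d hd rfl
    have hd0 : (0 : ℝ) < f.natDegree := by exact_mod_cast hd
    obtain ⟨s, hs, hs1⟩ := exists_between
      (show (f.natDegree : ℝ) / (f.natDegree + 1) < 1 by rw [div_lt_one] <;> linarith)
    have hs0 : 0 < s := lt_trans (by positivity) hs
    have hdim := le_dimH_positiveLiminfSet hd hs0 hs1
    refine ⟨lt_of_lt_of_le ?_ hdim, ?_⟩
    · have e : (f.natDegree : ℝ≥0∞) / ((f.natDegree : ℝ≥0∞) + 1) =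
          ENNReal.ofReal ((f.natDegree : ℝ) / (f.natDegree + 1)) := by
        rw [ENNReal.ofReal_div_of_pos (by positivity), ENNReal.ofReal_add (by positivity) zero_le_one,
          ENNReal.ofReal_natCast, ENNReal.ofReal_one]
      rw [e]
      exact (ENNReal.ofReal_lt_ofReal_iff hs0).2 hs
    · rw [Set.nonempty_iff_ne_empty]
      intro h
      rw [h, dimH_empty] at hdim
      exact absurd (ENNReal.ofReal_eq_zero.1 (le_antisymm hdim zero_le)) (not_le.2 hs0)
  refine ⟨main, fun h => ?_⟩
  obtain ⟨α, hα⟩ := (main (X ^ 2) 2 (by norm_num) (by simp)).2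
  have hα' : 0 < liminfNLogN (fun n : ℕ => (n : ℝ) ^ 2) α := by
    simpa [positiveLiminfSet] using hα
  exact hα'.ne' (h α)
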